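/- Let $M$ be a paracompact Hausdorff space (the phase space), let $R$ be a commutative ring with unit, and let $K\subseteq M$. The dynamics on $M$ is given by a flow $\varphi:\mathbb{R}\times M\to M$, a semiflow $\varphi:[0,\infty)\times M\to M$, or the iterates $\varphi_n=g^n$ ($n\in\mathbb{N}$) of a continuous map $g:M\to M$; flows and semiflows are jointly continuous with $\varphi_0=\mathrm{id}$ and $\varphi_{s+t}=\varphi_s\circ\varphi_t$. The basin of attraction $Z$ of $K$ is the set of all $p\in M$ such that for every neighbourhood $U$ of $K$ one has $\varphi_t(p)\in U$ for all sufficiently large $t$. The set $K$ is an (asymptotically stable) attractor if it is compact, has a neighbourhood contained in $Z$, and has a neighbourhood basis consisting of positively invariant sets (sets $P$ with $\varphi_t(P)\subseteq P$ for all $t\ge 0$). In that case $K\subseteq Z$. Let $\check H^q(X;R)$ denote Čech cohomology in its Alexander–Spanier form (which agrees with the usual Čech cohomology on paracompact Hausdorff spaces): let $\overline{C}^q(X;R)$ be the $R$-module of all maps $\xi:X^{q+1}\to R$ modulo the locally zero ones, i.e. those for which every point of $X$ has a neighbourhood $U$ with $\xi=0$ on $U^{q+1}$; then $\check H^q(X;R)$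 is the $q$-th cohomology of $\overline{C}^*(X;R)$ with the coboundary induced by $(\partial\xi)(z_0,\ldots,z_{q+1})=\sum_{j=0}^{q+1}(-1)^j\xi(z_0,\ldots,\widehat{z_j},\ldots,z_{q+1})$, and a continuous map $f$ induces $f^*$ by $(f^*\xi)(z_0,\ldots,z_q)=\xi(f(z_0),\ldots,f(z_q))$. (1) If $K$ is an attractor of a flow on $M$, then the inclusion $K\hookrightarrow Z$ induces isomorphisms of $R$-modules $\check H^q(Z;R)\to\check H^q(K;R)$ for all $q\ge 0$. (2) The same holds if $K$ is an attractor of a semiflow on $M$. (3) The same holds if $K$ is an attractor of the discrete dynamical system generated by a continuous map $g:M\to M$ such that $g|_Z$ is homotopic to the identity as a map of pairs $(Z,K)\to(Z,K)$, i.e. there is a continuous $H:[0,1]\times Z\to Z$ with $H_0=g|_Z$, $H_1=\mathrm{id}_Z$ and $H_t(K)\subseteq K$ for all $t\in[0,1]$. -/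

import Mathlib

open Set Filter Topology
open scoped NNReal unitInterval

noncomputable section

/-! ### Čech cohomology in its Alexander–Spanier form -/

namespace AlexanderSpanier

variable (R : Type*) [CommRing R]

/-- `C^q(X; R)`: all (set-theoretic) maps `X^{q+1} → R`. -/
abbrev Cochain (X : Type*) (q : ℕ) : Type _ := (Fin (q + 1) → X) → R

/-- The coboundary `(∂ξ)(z₀,…,z_{q+1}) = ∑ⱼ (-1)ʲ ξ(z₀,…,ẑⱼ,…,z_{q+1})`. -/
def d (X : Type*) (q : ℕ) : Cochain R X q →ₗ[R] Cochain R X (q + 1) where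
  toFun ξ := fun z => ∑ j : Fin (q + 2), (-1 : R) ^ (j : ℕ) * ξ (fun i => z (j.succAbove i))
  map_add' ξ η := by
    funext z
    simp [mul_add, Finset.sum_add_distrib]
  map_smul' c ξ := by
    funext z
    simp [Finset.mul_sum, mul_left_comm]

/-- The locally zero cochains: those `ξ` for which `X` has a covering by open sets such that
`ξ(z₀,…,z_q) = 0` whenever all `zᵢ` lie in a common member of the covering; that is, every point
has a neighbourhood `U` such that `ξ` vanishes on `U^{q+1}`. -/
def locallyZero (X : Type*) [TopologicalSpace X] (q : ℕ) : Submodule R (Cochain R X q) where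
  carrier := {ξ | ∀ x : X, ∃ U ∈ 𝓝 x, ∀ z : Fin (q + 1) → X, (∀ i, z i ∈ U) → ξ z = 0}
  add_mem' {ξ η} hξ hη x := by
    obtain ⟨U, hU, hU0⟩ := hξ x
    obtain ⟨V, hV, hV0⟩ := hη x
    exact ⟨U ∩ V, inter_mem hU hV, fun z hz => by
      simp [hU0 z fun i => (hz i).1, hV0 z fun i => (hz i).2]⟩
  zero_mem' _ := ⟨univ, univ_mem, fun _ _ => rfl⟩
  smul_mem' c ξ hξ x := by
    obtain ⟨U, hU, hU0⟩ := hξ x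
    exact ⟨U, hU, fun z hz => by simp [hU0 z hz]⟩

theorem locallyZero_le_comap_d (X : Type*) [TopologicalSpace X] (q : ℕ) :
    locallyZero R X q ≤ (locallyZero R X (q + 1)).comap (d R X q) := by
  intro ξ hξ x
  obtain ⟨U, hU, hU0⟩ := hξ x
  refine ⟨U, hU, fun z hz => ?_⟩
  change ∑ j : Fin (q + 2), (-1 : R) ^ (j : ℕ) * ξ (fun i => z (j.succAbove i)) = 0
  exact Finset.sum_eq_zero fun j _ => by rw [hU0 _ fun i => hz _, mul_zero]

/-- `C̄^q(X; R)`: cochains modulo locally zero cochains. -/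
abbrev QCochain (X : Type*) [TopologicalSpace X] (q : ℕ) : Type _ :=
  Cochain R X q ⧸ locallyZero R X q

/-- The coboundary of the quotient complex `C̄^*(X; R)`. -/
def dBar (X : Type*) [TopologicalSpace X] (q : ℕ) : QCochain R X q →ₗ[R] QCochain R X (q + 1) :=
  Submodule.mapQ _ _ (d R X q) (locallyZero_le_comap_d R X q)

/-- Cocycles of `C̄^*(X; R)`. -/
def cocycles (X : Type*) [TopologicalSpace X] (q : ℕ) : Submodule R (QCochain R X q) :=
  LinearMap.ker (dBar R X q)

/-- Coboundaries of `C̄^*(X; R)`; there are no cochains in negative degrees. -/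
def coboundaries (X : Type*) [TopologicalSpace X] : (q : ℕ) → Submodule R (QCochain R X q)
  | 0 => ⊥
  | q + 1 => LinearMap.range (dBar R X q)

/-- The cohomology `H^q(X; R)` of the complex `C̄^*(X; R)`: cocycles modulo coboundaries. -/
abbrev Cohomology (X : Type*) [TopologicalSpace X] (q : ℕ) : Type _ :=
  cocycles R X q ⧸ (coboundaries R X q).comap (cocycles R X q).subtype

variable {X Y : Type*}

/-- `(f^* ξ)(z₀,…,z_q) = ξ(f z₀,…,f z_q)`. -/
def pullback (f : X → Y) (q : ℕ) : Cochain R Y q →ₗ[R] Cochain R X q where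
  toFun ξ := fun z => ξ (fun i => f (z i))
  map_add' _ _ := rfl
  map_smul' _ _ := rfl

theorem d_pullback (f : X → Y) (q : ℕ) (ξ : Cochain R Y q) :
    d R X q (pullback R f q ξ) = pullback R f (q + 1) (d R Y q ξ) := rfl

variable [TopologicalSpace X] [TopologicalSpace Y]

theorem locallyZero_le_comap_pullback (f : C(X, Y)) (q : ℕ) :
    locallyZero R Y q ≤ (locallyZero R X q).comap (pullback R f q) := by
  intro ξ hξ x
  obtain ⟨U, hU, hU0⟩ := hξ (f x)
  exact ⟨f ⁻¹' U, f.continuous.continuousAt hU, fun z hz => hU0 _ hz⟩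

/-- The map `C̄^q(Y; R) → C̄^q(X; R)` induced by a continuous map. -/
def pullbackBar (f : C(X, Y)) (q : ℕ) : QCochain R Y q →ₗ[R] QCochain R X q :=
  Submodule.mapQ _ _ (pullback R f q) (locallyZero_le_comap_pullback R f q)

theorem dBar_pullbackBar (f : C(X, Y)) (q : ℕ) (c : QCochain R Y q) :
    dBar R X q (pullbackBar R f q c) = pullbackBar R f (q + 1) (dBar R Y q c) := by
  induction c using Submodule.Quotient.induction_on with
  | _ ξ => rfl

theorem pullbackBar_mem_cocycles (f : C(X, Y)) (q : ℕ) :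
    ∀ c ∈ cocycles R Y q, pullbackBar R f q c ∈ cocycles R X q := by
  intro c hc
  rw [cocycles, LinearMap.mem_ker] at hc ⊢
  rw [dBar_pullbackBar, hc, map_zero]

theorem pullbackBar_mem_coboundaries (f : C(X, Y)) (q : ℕ) :
    ∀ c ∈ coboundaries R Y q, pullbackBar R f q c ∈ coboundaries R X q := by
  intro c hc
  cases q with
  | zero =>
    have h0 : c = 0 := hc
    rw [h0, map_zero]
    exact Submodule.zero_mem _
  | succ q =>
    obtain ⟨b, rfl⟩ := hc
    exact ⟨pullbackBar R f q b, dBar_pullbackBar R f q b⟩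

/-- The homomorphism `f^* : H^q(Y; R) → H^q(X; R)` induced by a continuous map `f : X → Y`. -/
def cohomologyMap (f : C(X, Y)) (q : ℕ) : Cohomology R Y q →ₗ[R] Cohomology R X q :=
  Submodule.mapQ _ _
    ((pullbackBar R f q).restrict (pullbackBar_mem_cocycles R f q))
    (fun c hc => pullbackBar_mem_coboundaries R f q c.1 hc)

end AlexanderSpanier

/-! ### Attractors -/

namespace Dynamics

variable {τ M : Type*} [TopologicalSpace M]

/-- The basin of attraction of `K`: the points whose forward orbit eventually enters, and stays in,
every neighbourhood of `K`. Here `τ` is the time set (`ℝ`, `ℝ≥0` or `ℕ`). -/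
def basin [Preorder τ] (φ : τ → M → M) (K : Set M) : Set M :=
  {p | Tendsto (fun t => φ t p) atTop (𝓝ˢ K)}

/-- Asymptotically stable attractors: a compact set that has a neighbourhood all of whose points
are attracted to it, and a neighbourhood basis of positively invariant sets. -/
structure IsAttractor [Preorder τ] [Zero τ] (φ : τ → M → M) (K : Set M) : Prop where
  isCompact : IsCompact K
  attracts : ∃ V ∈ 𝓝ˢ K, ∀ p ∈ V, Tendsto (fun t => φ t p) atTop (𝓝ˢ K)
  stable : ∀ U ∈ 𝓝ˢ K, ∃ P ∈ 𝓝ˢ K, P ⊆ U ∧ IsForwardInvariant φ P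

theorem IsAttractor.subset_basin [Preorder τ] [Zero τ] {φ : τ → M → M} {K : Set M}
    (h : IsAttractor φ K) : K ⊆ basin φ K := by
  obtain ⟨V, hV, hV'⟩ := h.attracts
  exact fun p hp => hV' p (subset_of_mem_nhdsSet hV hp)

/-- The inclusion of an attractor into its basin of attraction, as a continuous map. -/
def IsAttractor.inclusion [Preorder τ] [Zero τ] {φ : τ → M → M} {K : Set M}
    (h : IsAttractor φ K) : C(K, basin φ K) :=
  ⟨Set.inclusion h.subset_basin, continuous_inclusion h.subset_basin⟩

/-- The discrete (semi)dynamical system generated by a map. -/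
def iterates (g : M → M) : ℕ → M → M := fun n => g^[n]

theorem mapsTo_basin (g : M → M) (K : Set M) :
    MapsTo g (basin (iterates g) K) (basin (iterates g) K) := by
  intro p hp
  exact (tendsto_add_atTop_iff_nat (f := fun n => g^[n] p) 1).2 hp

/-- The restriction of a continuous map `g` to the basin of attraction of `K`. -/
def basinMap (g : C(M, M)) (K : Set M) : C(basin (iterates g) K, basin (iterates g) K) :=
  ⟨(mapsTo_basin g K).restrict g _ _, g.continuous.restrict (mapsTo_basin g K)⟩

/-- The generator `g` is homotopic to the identity as a map of pairs `(Z, K) → (Z, K)`, where `Z`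
is the basin of attraction of `K`: all stages of the homotopy carry `K` into `K`. -/
def HomotopicToIdOnPair (g : C(M, M)) (K : Set M) : Prop :=
  ContinuousMap.HomotopicWith (basinMap g K) (ContinuousMap.id (basin (iterates g) K))
    (fun h => ∀ z : basin (iterates g) K, (z : M) ∈ K → (h z : M) ∈ K)

end Dynamics

end

/-! Cohomology of the compact set `K` is taut: each class on `K` extends to an open neighbourhood
`U`, and a class on `Z` that vanishes on `K` vanishes on some `U`. The dynamics carries all of `Z`
into any such `U`: with a travel time `T(x)` continuous in `x` one gets `r : Z → U`, homotopic to
the identity in `Z` and, on `K`, homotopic within `U` to the inclusion. So if `c` vanishes on `U`,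
then `c = r^*(c|U) = 0`; and if `c'` on `U` extends a class of `K`, so does `r^* c'`. This is
`bijective_cohomologyMap_of_absorbing`.

Cochains can be pulled back along discontinuous maps, so for tautness a discontinuous
near-retraction (`exists_near_retraction`) suffices. Maps joined by short steps are compared by
prism operators (`mk_pullback_sub_mem_coboundaries`), which also gives homotopy invariance.
Partitions of unity on `Z` supply `T` and the step lengths, whence the need for `Z` to be
paracompact (`paracompactSpace_of_iUnion_closed`). For a map `g`, the homotopy from the identity to
`g` is telescoped (`exists_telescope`); the result need not be a semiflow, and no semigroup law is
needed. -/

namespace AlexanderSpanier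

/-! ### Prism operators -/

section Prism

variable {R : Type*} [CommRing R] {X Y : Type*}

/-- The coboundary on functions of `n` variables, including the augmentation `n = 0`. -/
def augD (n : ℕ) (ξ : (Fin n → X) → R) : (Fin (n + 1) → X) → R :=
  fun z => ∑ j : Fin (n + 1), (-1 : R) ^ (j : ℕ) * ξ (fun i => z (j.succAbove i))

theorem augD_cons (n : ℕ) (ξ : (Fin (n + 1) → X) → R) (x : X) (z : Fin (n + 1) → X) :
    augD (n + 1) ξ (Fin.cons x z) =
      ξ z - augD n (fun w => ξ (Fin.cons x w)) z := by
  unfold augD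
  rw [Fin.sum_univ_succ, sub_eq_add_neg, ← Finset.sum_neg_distrib]
  congr 1
  · simp
  · refine Finset.sum_congr rfl fun j _ => ?_
    have h : (fun i => (Fin.cons x z : Fin (n + 2) → X) (j.succ.succAbove i)) =
        (Fin.cons x fun i => z (j.succAbove i) : Fin (n + 1) → X) := by
      funext i
      refine Fin.cases ?_ (fun i => ?_) i
      · simp
      · simp
    rw [h, Fin.val_succ, pow_succ]
    ring

theorem augD_sub (n : ℕ) (ξ η : (Fin n → X) → R) (z : Fin (n + 1) → X) :
    augD n (fun w => ξ w - η w) z = augD n ξ z - augD n η z := by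
  simp [augD, mul_sub, Finset.sum_sub_distrib]

/-- The prism operator of two maps `a`, `b`:
`(x₁,…,xₙ) ↦ ∑ᵢ (-1)ⁱ⁻¹ ξ(a x₁,…,a xᵢ,b xᵢ,…,b xₙ)`. -/
def prism (a b : X → Y) : (n : ℕ) → ((Fin (n + 1) → Y) → R) → (Fin n → X) → R
  | 0, _ => fun _ => 0
  | n + 1, ξ => fun z => ξ (Fin.cons (a (z 0)) fun i => b (z i)) -
      prism a b n (fun w => ξ (Fin.cons (a (z 0)) w)) (Fin.tail z)

theorem prism_sub (a b : X → Y) : ∀ (n : ℕ) (ξ η : (Fin (n + 1) → Y) → R) (z : Fin n → X),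
    prism a b n (fun w => ξ w - η w) z = prism a b n ξ z - prism a b n η z
  | 0, _, _, _ => by simp [prism]
  | n + 1, ξ, η, z => by
    simp only [prism]
    rw [prism_sub a b n]
    ring

theorem prism_congr {a b a' b' : X → Y} : ∀ (n : ℕ) (ξ : (Fin (n + 1) → Y) → R) (z : Fin n → X),
    (∀ i, a (z i) = a' (z i)) → (∀ i, b (z i) = b' (z i)) → prism a b n ξ z = prism a' b' n ξ z
  | 0, _, _, _, _ => rfl
  | n + 1, ξ, z, ha, hb => by
    simp only [prism, ha, hb]
    rw [prism_congr n _ (Fin.tail z) (fun i => ha i.succ) fun i => hb i.succ]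

theorem prism_eq_zero {a b : X → Y} {V : Set Y} : ∀ (n : ℕ) (ξ : (Fin (n + 1) → Y) → R)
    (z : Fin n → X), (∀ w : Fin (n + 1) → Y, (∀ i, w i ∈ V) → ξ w = 0) →
    (∀ i, a (z i) ∈ V) → (∀ i, b (z i) ∈ V) → prism a b n ξ z = 0
  | 0, _, _, _, _, _ => rfl
  | n + 1, ξ, z, hξ, ha, hb => by
    simp only [prism]
    rw [hξ _ fun i => Fin.cases (ha 0) (fun i => hb i) i,
      prism_eq_zero n _ (Fin.tail z) (fun w hw => hξ _ fun i => Fin.cases (ha 0) hw i)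
        (fun i => ha i.succ) fun i => hb i.succ, sub_zero]

theorem prism_cons (a b : X → Y) (n : ℕ) (ξ : (Fin (n + 2) → Y) → R) (x : X) (z : Fin n → X) :
    prism a b (n + 1) ξ (Fin.cons x z) =
      ξ (Fin.cons (a x) (Fin.cons (b x) fun i => b (z i))) -
        prism a b n (fun w => ξ (Fin.cons (a x) w)) z := by
  simp only [prism, Fin.cons_zero, Fin.tail_cons]
  congr 3
  funext i
  exact Fin.cases rfl (fun _ => rfl) i

/-- The prism operator is a cochain homotopy from `a` to `b`. -/
theorem augD_prism (a b : X → Y) (n : ℕ) (ξ : (Fin (n + 1) → Y) → R) (z : Fin (n + 1) → X) :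
    augD n (prism a b n ξ) z + prism a b (n + 1) (augD (n + 1) ξ) z =
      ξ (fun i => b (z i)) - ξ (fun i => a (z i)) := by
  have hcons (f : X → Y) (m : ℕ) (x : X) (z : Fin m → X) :
      (fun i => f ((Fin.cons x z : Fin (m + 1) → X) i)) = Fin.cons (f x) fun i => f (z i) := by
    funext i
    exact Fin.cases rfl (fun _ => rfl) i
  induction n with
  | zero =>
    obtain ⟨x, z, rfl⟩ : ∃ x z', z = Fin.cons x z' := ⟨z 0, Fin.tail z, by simp⟩
    rw [prism_cons, augD_cons, hcons, hcons]
    simp [augD, prism, Subsingleton.elim _ (fun i => a (z i))]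
  | succ n ih =>
    obtain ⟨x, z, rfl⟩ : ∃ x z', z = Fin.cons x z' := ⟨z 0, Fin.tail z, by simp⟩
    have e1 : augD n (fun w => prism a b (n + 1) ξ (Fin.cons x w)) z =
        augD n (fun w : Fin n → Y => ξ (Fin.cons (a x) (Fin.cons (b x) w))) (fun i => b (z i)) -
          augD n (prism a b n fun w => ξ (Fin.cons (a x) w)) z := by
      simp only [prism_cons, augD_sub]
      rfl
    rw [augD_cons, e1, prism_cons, hcons, hcons, augD_cons, augD_cons]
    simp only [augD_cons, prism_sub]
    -- The two terms `prism a b (n + 1) ξ z` cancel; what remains is the claim for the slice of `ξ`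
    -- with first vertex `a x`.
    linear_combination ih (fun w => ξ (Fin.cons (a x) w)) z

end Prism

/-! ### Cohomology classes through representing cochains -/

section Classes

variable {R : Type*} [CommRing R] {X Y : Type*} [TopologicalSpace X] [TopologicalSpace Y]

/-- The cohomology class of a cochain whose coboundary is locally zero. -/
def mkClass {q : ℕ} (ξ : Cochain R X q) (h : d R X q ξ ∈ locallyZero R X (q + 1)) :
    Cohomology R X q :=
  Submodule.Quotient.mk ⟨Submodule.Quotient.mk ξ, by
    rw [cocycles, LinearMap.mem_ker]
    exact (Submodule.Quotient.mk_eq_zero _).2 h⟩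

theorem exists_mkClass_eq {q : ℕ} (c : Cohomology R X q) :
    ∃ ξ : Cochain R X q, ∃ h : d R X q ξ ∈ locallyZero R X (q + 1), mkClass ξ h = c := by
  induction c using Submodule.Quotient.induction_on with
  | _ c =>
    obtain ⟨c, hc⟩ := c
    induction c using Submodule.Quotient.induction_on with
    | _ ξ => exact ⟨ξ, (Submodule.Quotient.mk_eq_zero _).1 hc, rfl⟩

theorem mkClass_eq_mkClass_iff {q : ℕ} {ξ η : Cochain R X q}
    {hξ : d R X q ξ ∈ locallyZero R X (q + 1)} {hη : d R X q η ∈ locallyZero R X (q + 1)} :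
    mkClass ξ hξ = mkClass η hη ↔ Submodule.Quotient.mk (ξ - η) ∈ coboundaries R X q := by
  rw [mkClass, mkClass, Submodule.Quotient.eq]
  rfl

theorem mkClass_eq_zero_iff {q : ℕ} {ξ : Cochain R X q}
    {hξ : d R X q ξ ∈ locallyZero R X (q + 1)} :
    mkClass ξ hξ = 0 ↔ Submodule.Quotient.mk ξ ∈ coboundaries R X q := by
  rw [mkClass, Submodule.Quotient.mk_eq_zero]
  rfl

theorem d_pullback_mem_locallyZero (f : C(X, Y)) {q : ℕ} {ξ : Cochain R Y q}
    (h : d R Y q ξ ∈ locallyZero R Y (q + 1)) :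
    d R X q (pullback R f q ξ) ∈ locallyZero R X (q + 1) := by
  rw [d_pullback]
  exact locallyZero_le_comap_pullback R f (q + 1) h

theorem cohomologyMap_mkClass (f : C(X, Y)) {q : ℕ} {ξ : Cochain R Y q}
    (h : d R Y q ξ ∈ locallyZero R Y (q + 1)) :
    cohomologyMap R f q (mkClass ξ h) =
      mkClass (pullback R f q ξ) (d_pullback_mem_locallyZero f h) :=
  rfl

theorem cohomologyMap_comp {Z : Type*} [TopologicalSpace Z] (g : C(Y, Z)) (f : C(X, Y)) (q : ℕ)
    (c : Cohomology R Z q) :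
    cohomologyMap R (g.comp f) q c = cohomologyMap R f q (cohomologyMap R g q c) := by
  obtain ⟨ξ, h, rfl⟩ := exists_mkClass_eq c
  rfl

theorem cohomologyMap_id (q : ℕ) (c : Cohomology R X q) :
    cohomologyMap R (ContinuousMap.id X) q c = c := by
  obtain ⟨ξ, h, rfl⟩ := exists_mkClass_eq c
  rfl

theorem mk_mem_coboundaries_of_locallyZero {q : ℕ} {ξ : Cochain R X q}
    (h : ξ ∈ locallyZero R X q) : Submodule.Quotient.mk ξ ∈ coboundaries R X q := by
  rw [(Submodule.Quotient.mk_eq_zero _).2 h]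
  exact Submodule.zero_mem _

theorem mk_mem_coboundaries_succ_iff {q : ℕ} {ξ : Cochain R X (q + 1)} :
    Submodule.Quotient.mk ξ ∈ coboundaries R X (q + 1) ↔
      ∃ η : Cochain R X q, ξ - d R X q η ∈ locallyZero R X (q + 1) := by
  constructor
  · rintro ⟨c, hc⟩
    induction c using Submodule.Quotient.induction_on with
    | _ η => exact ⟨η, (Submodule.Quotient.eq _).1 hc.symm⟩
  · rintro ⟨η, hη⟩
    exact ⟨Submodule.Quotient.mk η, ((Submodule.Quotient.eq _).2 hη).symm⟩

end Classes

/-! ### Contiguous sequences of maps and homotopy invariance -/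

section Contiguity

variable {R : Type*} [CommRing R] {X Y : Type*}

/-- The sum of the prism operators of consecutive maps in a sequence, each corrected by the
degenerate prism operator so that the sum is finite where the sequence is eventually constant. -/
noncomputable def chainPrism (s : ℕ → X → Y) (n : ℕ) (ξ : (Fin (n + 1) → Y) → R) :
    (Fin n → X) → R :=
  fun z => ∑ᶠ j, (prism (s j) (s (j + 1)) n ξ z - prism (s j) (s j) n ξ z)

theorem chainPrism_eq_sum (s : ℕ → X → Y) (n : ℕ) (ξ : (Fin (n + 1) → Y) → R) (z : Fin n → X)
    {N : ℕ} (hN : ∀ j ≥ N, ∀ i, s (j + 1) (z i) = s j (z i)) :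
    chainPrism s n ξ z = ∑ j ∈ Finset.range N,
      (prism (s j) (s (j + 1)) n ξ z - prism (s j) (s j) n ξ z) := by
  refine finsum_eq_sum_of_support_subset _ fun j hj => ?_
  by_contra hj'
  refine hj (sub_eq_zero.2 (prism_congr n ξ z (fun _ => rfl) fun i => hN j ?_ i))
  simpa using hj'

/-- The homotopy formulas of consecutive prisms telescope. The degenerate prisms do not disturb
this, as they join `s j` to itself. -/
theorem augD_chainPrism {s : ℕ → X → Y} {g : X → Y} (hs : ∀ x, ∃ N, ∀ j ≥ N, s j x = g x)
    (n : ℕ) (ξ : (Fin (n + 1) → Y) → R) (z : Fin (n + 1) → X) :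
    augD n (chainPrism s n ξ) z + chainPrism s (n + 1) (augD (n + 1) ξ) z =
      ξ (fun i => g (z i)) - ξ (fun i => s 0 (z i)) := by
  choose N hN using hs
  set m := Finset.univ.sup fun i => N (z i)
  have hm : ∀ j ≥ m, ∀ i, s j (z i) = g (z i) := fun j hj i =>
    hN _ _ ((Finset.le_sup (f := fun i => N (z i)) (Finset.mem_univ i)).trans hj)
  have hm' : ∀ j ≥ m, ∀ i, s (j + 1) (z i) = s j (z i) := fun j hj i => by
    rw [hm j hj, hm (j + 1) (by omega)]
  have h1 : augD n (chainPrism s n ξ) z = ∑ j ∈ Finset.range m,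
      (augD n (prism (s j) (s (j + 1)) n ξ) z - augD n (prism (s j) (s j) n ξ) z) := by
    have : ∀ k : Fin (n + 1), chainPrism s n ξ (fun i => z (k.succAbove i)) = _ := fun k =>
      chainPrism_eq_sum s n ξ (fun i => z (k.succAbove i)) fun j hj i => hm' j hj _
    simp only [augD, this, Finset.mul_sum, mul_sub, ← Finset.sum_sub_distrib]
    exact Finset.sum_comm
  rw [h1, chainPrism_eq_sum s _ _ z hm', ← Finset.sum_add_distrib]
  have h2 : ∀ j ∈ Finset.range m,
      augD n (prism (s j) (s (j + 1)) n ξ) z - augD n (prism (s j) (s j) n ξ) z +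
        (prism (s j) (s (j + 1)) (n + 1) (augD (n + 1) ξ) z -
          prism (s j) (s j) (n + 1) (augD (n + 1) ξ) z) =
      ξ (fun i => s (j + 1) (z i)) - ξ (fun i => s j (z i)) := fun j _ => by
    linear_combination augD_prism (s j) (s (j + 1)) n ξ z - augD_prism (s j) (s j) n ξ z
  rw [Finset.sum_congr rfl h2, Finset.sum_range_sub fun j => ξ (fun i => s j (z i))]
  simp only [hm m le_rfl]

/-- Let `s` be a sequence of maps, not necessarily continuous, that is locally finally equal to `g`
and whose consecutive members are locally contiguous with respect to `∂ξ`. Then the pullbacks of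
`ξ` under `s 0` and `g` differ by a coboundary. -/
theorem mk_pullback_sub_mem_coboundaries [TopologicalSpace X] {s : ℕ → X → Y} {g : X → Y} {q : ℕ}
    (ξ : Cochain R Y q)
    (hs : ∀ x, ∃ N, ∃ W ∈ 𝓝 x, (∀ j ≥ N, ∀ w ∈ W, s j w = g w) ∧ ∀ j < N, ∃ V : Set Y,
      MapsTo (s j) W V ∧ MapsTo (s (j + 1)) W V ∧
        ∀ z : Fin (q + 2) → Y, (∀ i, z i ∈ V) → d R Y q ξ z = 0) :
    Submodule.Quotient.mk (pullback R g q ξ - pullback R (s 0) q ξ) ∈ coboundaries R X q := by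
  have hg : ∀ x, ∃ N, ∀ j ≥ N, s j x = g x := fun x => by
    obtain ⟨N, W, hW, h, -⟩ := hs x
    exact ⟨N, fun j hj => h j hj x (mem_of_mem_nhds hW)⟩
  have key : pullback R g q ξ - pullback R (s 0) q ξ =
      augD q (chainPrism s q ξ) + chainPrism s (q + 1) (augD (q + 1) ξ) :=
    funext fun z => (augD_chainPrism hg q ξ z).symm
  have hz : chainPrism s (q + 1) (augD (q + 1) ξ) ∈ locallyZero R X q := fun x => by
    obtain ⟨N, W, hW, h, h'⟩ := hs x
    refine ⟨W, hW, fun z hz => ?_⟩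
    rw [chainPrism_eq_sum s _ _ z (N := N) fun j hj i => by
      rw [h j hj _ (hz i), h (j + 1) (by omega) _ (hz i)]]
    refine Finset.sum_eq_zero fun j hj => ?_
    obtain ⟨V, h1, h2, hV⟩ := h' j (Finset.mem_range.1 hj)
    change ∀ z, _ → augD (q + 1) ξ z = 0 at hV
    rw [prism_eq_zero _ _ z hV (fun i => h1 (hz i)) fun i => h2 (hz i),
      prism_eq_zero _ _ z hV (fun i => h1 (hz i)) fun i => h1 (hz i), sub_zero]
  rw [key]
  cases q with
  -- There are no coboundaries in degree 0, so the difference itself must be locally zero; indeed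
  -- the prism operator on 0 variables is zero.
  | zero =>
    refine mk_mem_coboundaries_of_locallyZero ?_
    have h0 : augD 0 (chainPrism s 0 ξ) = 0 := by
      funext z
      simp [augD, chainPrism, prism]
    rw [h0, zero_add (chainPrism s _ _)]
    exact hz
  | succ q =>
    refine mk_mem_coboundaries_succ_iff.2 ⟨chainPrism s (q + 1) ξ, ?_⟩
    have : d R X q (chainPrism s (q + 1) ξ) = augD (q + 1) (chainPrism s (q + 1) ξ) := rfl
    rw [this, add_sub_cancel_left]
    exact hz

/-- Homotopic maps on a paracompact Hausdorff space induce the same map in cohomology. -/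
theorem cohomologyMap_eq_of_homotopy [TopologicalSpace X] [TopologicalSpace Y] [T2Space X]
    [ParacompactSpace X] {f g : C(X, Y)} (H : f.Homotopy g) (q : ℕ) :
    cohomologyMap R f q = cohomologyMap R g q := by
  refine LinearMap.ext fun c => ?_
  obtain ⟨ξ, hξ, rfl⟩ := exists_mkClass_eq c
  rw [cohomologyMap_mkClass, cohomologyMap_mkClass, eq_comm, mkClass_eq_mkClass_iff]
  -- `G` records the permitted time steps over each point. It is an open neighbourhood of the
  -- diagonal times `X`, so compactness of `I` yields a step length valid near each point.
  let G : Set ((I × I) × X) := {p | ∃ V : Set Y, IsOpen V ∧ H (p.1.1, p.2) ∈ V ∧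
    H (p.1.2, p.2) ∈ V ∧ ∀ z : Fin (q + 2) → Y, (∀ i, z i ∈ V) → d R Y q ξ z = 0}
  have hGo : IsOpen G := by
    have : G = ⋃ V ∈ {V : Set Y | IsOpen V ∧
        ∀ z : Fin (q + 2) → Y, (∀ i, z i ∈ V) → d R Y q ξ z = 0},
        {p : (I × I) × X | H (p.1.1, p.2) ∈ V ∧ H (p.1.2, p.2) ∈ V} := by
      ext p
      simp only [G, mem_ofPred_eq, mem_iUnion, exists_prop]
      exact exists_congr fun V => by tauto
    rw [this]
    refine isOpen_biUnion fun V hV => ?_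
    exact (hV.1.preimage (by fun_prop : Continuous fun p : (I × I) × X => H (p.1.1, p.2))).inter
      (hV.1.preimage (by fun_prop : Continuous fun p : (I × I) × X => H (p.1.2, p.2)))
  have hδ (x : X) : ∃ δ > 0, ∀ᶠ w in 𝓝 x, ∀ t t' : I, dist t t' ≤ δ → ((t, t'), w) ∈ G := by
    obtain ⟨u, v, hu, hv, hdu, hxv, huv⟩ := generalized_tube_lemma (s := diagonal I) (t := {x})
      isCompact_diagonal isCompact_singleton hGo (by
        rintro ⟨⟨t, t'⟩, w⟩ ⟨ht, -⟩
        obtain rfl : t = t' := ht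
        obtain ⟨U, hU, hU0⟩ := hξ (H (t, w))
        obtain ⟨V, hVU, hVo, hV⟩ := mem_nhds_iff.1 hU
        exact ⟨V, hVo, hV, hV, fun z hz => hU0 z fun i => hVU (hz i)⟩)
    have hu' : u ∈ uniformity I := by
      rw [← nhdsSet_diagonal_eq_uniformity]
      exact hu.mem_nhdsSet.2 hdu
    obtain ⟨δ, hδ0, hδ⟩ := Metric.mem_uniformity_dist.1 hu'
    refine ⟨δ / 2, by positivity, ?_⟩
    filter_upwards [hv.mem_nhds (hxv rfl)] with w hw t t' htt
    exact huv ⟨hδ (by linarith), hw⟩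
  -- Permitted step lengths form an interval, so a partition of unity glues the local ones to a
  -- continuous `ε`. Then `τ j = min(1, j ε)` reaches 1 after locally boundedly many steps.
  obtain ⟨ε, hε⟩ := exists_continuous_forall_mem_convex_of_local_const (X := X)
    (t := fun x => {e : ℝ | 0 < e ∧ ∀ t t' : I, dist t t' ≤ e → ((t, t'), x) ∈ G})
    (fun x => by
      refine OrdConnected.convex ⟨fun a ha b hb c hc => ?_⟩
      exact ⟨ha.1.trans_le hc.1, fun t t' h => hb.2 t t' (h.trans hc.2)⟩)
    (fun x => by
      obtain ⟨δ, hδ0, hδ⟩ := hδ x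
      exact ⟨δ, hδ.mono fun y hy => ⟨hδ0, hy⟩⟩)
  let τ : ℕ → X → I := fun j x => projIcc 0 1 zero_le_one (j * ε x)
  have hτc (j : ℕ) : Continuous (τ j) := continuous_projIcc.comp (by fun_prop)
  have hτ (j : ℕ) (x : X) : ((τ j x, τ (j + 1) x), x) ∈ G := by
    refine (hε x).2 _ _ ?_
    refine (LipschitzWith.projIcc zero_le_one).dist_le_mul _ _ |>.trans ?_
    rw [Real.dist_eq, show (j : ℝ) * ε x - (j + 1 : ℕ) * ε x = -ε x by push_cast; ring, abs_neg,
      abs_of_pos (hε x).1]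
    simp
  have hs0 : pullback R f q ξ = pullback R (fun x => H (τ 0 x, x)) q ξ := by
    have : ∀ x, τ 0 x = 0 := fun x => by
      simp only [τ]
      simp
    simp only [this, H.apply_zero]
  rw [hs0]
  refine mk_pullback_sub_mem_coboundaries (s := fun j x => H (τ j x, x)) ξ fun x => ?_
  obtain ⟨N, hN⟩ := exists_nat_gt (1 / ε x)
  have hN' : ∀ᶠ w in 𝓝 x, 1 < N * ε w := by
    refine (by fun_prop : Continuous fun w => N * ε w).continuousAt.eventually_const_lt ?_
    rwa [div_lt_iff₀ (hε x).1] at hN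
  have hV : ∀ j, ∃ V : Set Y, (∀ᶠ w in 𝓝 x, H (τ j w, w) ∈ V ∧ H (τ (j + 1) w, w) ∈ V) ∧
      ∀ z : Fin (q + 2) → Y, (∀ i, z i ∈ V) → d R Y q ξ z = 0 := fun j => by
    obtain ⟨V, hVo, h1, h2, hV⟩ := hτ j x
    refine ⟨V, ?_, hV⟩
    have hc (k : ℕ) : Continuous fun w => H (τ k w, w) := by
      have := hτc k
      fun_prop
    exact ((hc j).continuousAt.eventually_mem (hVo.mem_nhds h1)).and
      ((hc (j + 1)).continuousAt.eventually_mem (hVo.mem_nhds h2))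
  choose V hVx hV using hV
  refine ⟨N, _, inter_mem hN' ((Finset.range N).iInter_mem_sets.2 fun j _ => hVx j), ?_, ?_⟩
  · rintro j hj w ⟨hw, -⟩
    have : τ j w = 1 := by
      refine projIcc_eq_one.2 (hw.le.trans ?_)
      gcongr
      exact (hε w).1.le
    simp [this]
  · intro j hj
    refine ⟨V j, fun w hw => ?_, fun w hw => ?_, hV j⟩
    · exact (mem_iInter₂.1 hw.2 j (Finset.mem_range.2 hj)).1
    · exact (mem_iInter₂.1 hw.2 j (Finset.mem_range.2 hj)).2

end Contiguity

/-! ### Tautness of compact subspaces -/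

section Tautness

variable {R : Type*} [CommRing R] {X L : Type*} [TopologicalSpace X] [TopologicalSpace L]

/-- A compact subspace `L` of a normal space is a retract of a neighbourhood under a map that,
while not continuous, moves points arbitrarily little near `L`. -/
theorem exists_near_retraction [T2Space X] [NormalSpace X] [CompactSpace L] (i : C(L, X))
    (hi : Function.Injective i) (V : L → Set X) (hV : ∀ l, IsOpen (V l)) (hiV : ∀ l, i l ∈ V l) :
    ∃ U : Set X, IsOpen U ∧ (∀ l, i l ∈ U) ∧ ∃ r : U → L, (∀ l h, r ⟨i l, h⟩ = l) ∧
      ∀ x : U, ∃ W ∈ 𝓝 x, ∃ l, ∀ w ∈ W, (w : X) ∈ V l ∧ i (r w) ∈ V l := by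
  have hK : IsCompact (range i) := isCompact_range i.continuous
  obtain ⟨t, ht⟩ := hK.elim_finite_subcover V hV
    (range_subset_iff.2 fun l => mem_iUnion.2 ⟨l, hiV l⟩)
  obtain ⟨v, hv, hvo, hvV⟩ := exists_subset_iUnion_closure_subset (u := fun j : t => V j)
    hK.isClosed (fun j => hV j) (fun x _ => toFinite _) (by simpa [iUnion_subtype] using ht)
  -- A point `x` of `U` has a companion `l` such that `i l` lies in every `closure (v j)` containing
  -- `x`. Finiteness of the cover makes `U` open; a point `i l` has companion `l`.
  let U : Set X := (⋃ j, v j) ∩ ⋃ l, ⋂ j ∈ {j : t | i l ∉ closure (v j)}, (closure (v j))ᶜ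
  have hU (x : U) : ∃ l, (∀ j, (x : X) ∈ closure (v j) → i l ∈ closure (v j)) ∧
      ∀ l', i l' = x → l = l' := by
    by_cases hx : ∃ l, i l = x
    · obtain ⟨l, hl⟩ := hx
      exact ⟨l, fun j hj => hl ▸ hj, fun l' hl' => hi (hl.trans hl'.symm)⟩
    · obtain ⟨l, hl⟩ := mem_iUnion.1 x.2.2
      refine ⟨l, fun j hj => ?_, fun l' hl' => (hx ⟨l', hl'⟩).elim⟩
      by_contra hj'
      exact mem_iInter₂.1 hl j hj' hj
  choose r hr hr' using hU
  refine ⟨U, ?_, fun l => ⟨hv (mem_range_self l), mem_iUnion.2 ⟨l, mem_iInter₂.2 fun j hj => hj⟩⟩,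
    r, fun l h => hr' _ l rfl, fun x => ?_⟩
  · exact (isOpen_iUnion hvo).inter (isOpen_iUnion fun l =>
      (toFinite _).isOpen_biInter fun j _ => isClosed_closure.isOpen_compl)
  · obtain ⟨j, hj⟩ := mem_iUnion.1 x.2.1
    refine ⟨Subtype.val ⁻¹' v j, ((hvo j).preimage continuous_subtype_val).mem_nhds hj, j,
      fun w hw => ⟨hvV j (subset_closure hw), hvV j (hr w j (subset_closure hw))⟩⟩

/-- The corestriction of a continuous map to a subset containing its image. -/
def corestrict (i : C(L, X)) (U : Set X) (hU : ∀ l, i l ∈ U) : C(L, U) :=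
  ⟨fun l => ⟨i l, hU l⟩, i.continuous.subtype_mk hU⟩

/-- The inclusion of a subset. -/
def subsetIncl (U : Set X) : C(U, X) := ⟨Subtype.val, continuous_subtype_val⟩

theorem exists_open_of_mem_locallyZero {i : C(L, X)} (hi : IsInducing i) {q : ℕ}
    {ξ : Cochain R L q} (h : ξ ∈ locallyZero R L q) (l : L) :
    ∃ V : Set X, IsOpen V ∧ i l ∈ V ∧ ∀ z : Fin (q + 1) → L, (∀ k, i (z k) ∈ V) → ξ z = 0 := by
  obtain ⟨N, hN, hN0⟩ := h l
  rw [hi.nhds_eq_comap] at hN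
  obtain ⟨V, hV, hVN⟩ := hN
  obtain ⟨V', hV', hVo, hl⟩ := mem_nhds_iff.1 hV
  exact ⟨V', hVo, hl, fun z hz => hN0 z fun k => hVN (hV' (hz k))⟩

/-- The pullback under a sufficiently fine near-retraction is still a cocycle, and it restricts to
the given cochain exactly. -/
theorem exists_cohomologyMap_corestrict_eq [T2Space X] [NormalSpace X] [CompactSpace L]
    (i : C(L, X)) (hi : Function.Injective i) {q : ℕ} (c : Cohomology R L q) :
    ∃ (U : Set X) (hU : ∀ l, i l ∈ U) (c' : Cohomology R U q), IsOpen U ∧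
      cohomologyMap R (corestrict i U hU) q c' = c := by
  obtain ⟨ξ, hξ, rfl⟩ := exists_mkClass_eq c
  choose V hVo hiV hV using exists_open_of_mem_locallyZero
    (i.continuous.isClosedEmbedding hi).isInducing hξ
  obtain ⟨U, hUo, hU, r, hr, hrV⟩ := exists_near_retraction i hi V hVo hiV
  have hd : d R U q (pullback R r q ξ) ∈ locallyZero R U (q + 1) := fun x => by
    obtain ⟨W, hW, l, hl⟩ := hrV x
    exact ⟨W, hW, fun z hz => hV l _ fun k => (hl _ (hz k)).2⟩
  refine ⟨U, hU, mkClass _ hd, hUo, ?_⟩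
  rw [cohomologyMap_mkClass, mkClass_eq_mkClass_iff]
  have : pullback R (corestrict i U hU) q (pullback R r q ξ) = ξ := by
    funext z
    exact congrArg ξ (funext fun k => hr (z k) (hU _))
  rw [this, sub_self]
  exact Submodule.zero_mem _

/-- Write `ζ = ∂η + θ`, with `θ = ζ` in degree 0. Even a discontinuous `r` pulls `∂η` back to a
coboundary, so only `θ` restricts the choice of `r`. -/
theorem exists_locallyZero_of_mem_coboundaries {q : ℕ} {ζ : Cochain R L q}
    (h : Submodule.Quotient.mk ζ ∈ coboundaries R L q) :
    ∃ θ ∈ locallyZero R L q, ∀ (U : Set X) (r : U → L),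
      pullback R r q θ ∈ locallyZero R U q →
        Submodule.Quotient.mk (pullback R r q ζ) ∈ coboundaries R U q := by
  cases q with
  | zero =>
    exact ⟨ζ, (Submodule.Quotient.mk_eq_zero _).1 h, fun U r hr =>
      mk_mem_coboundaries_of_locallyZero hr⟩
  | succ q =>
    obtain ⟨η, hη⟩ := mk_mem_coboundaries_succ_iff.1 h
    exact ⟨_, hη, fun U r hr => mk_mem_coboundaries_succ_iff.2 ⟨pullback R r q η, hr⟩⟩

/-- On `U` the inclusion and `i ∘ r` are contiguous with respect to `∂ξ`, and `(i ∘ r)^* ξ = r^*(i^*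
ξ)` is a coboundary because `i^* ξ` is one. -/
theorem exists_cohomologyMap_subsetIncl_eq_zero [T2Space X] [NormalSpace X] [CompactSpace L]
    (i : C(L, X)) (hi : Function.Injective i) {q : ℕ} (c : Cohomology R X q)
    (hc : cohomologyMap R i q c = 0) :
    ∃ U : Set X, IsOpen U ∧ (∀ l, i l ∈ U) ∧ cohomologyMap R (subsetIncl U) q c = 0 := by
  obtain ⟨ξ, hξ, rfl⟩ := exists_mkClass_eq c
  rw [cohomologyMap_mkClass, mkClass_eq_zero_iff] at hc
  obtain ⟨θ, hθ, hθr⟩ := exists_locallyZero_of_mem_coboundaries (X := X) hc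
  choose V hVo hiV hV using exists_open_of_mem_locallyZero
    (i.continuous.isClosedEmbedding hi).isInducing hθ
  choose V' hVo' hiV' hV' using exists_open_of_mem_locallyZero (i := ContinuousMap.id X)
    IsInducing.id hξ
  obtain ⟨U, hUo, hU, r, hr, hrV⟩ := exists_near_retraction i hi (fun l => V l ∩ V' (i l))
    (fun l => (hVo l).inter (hVo' _)) fun l => ⟨hiV l, hiV' _⟩
  refine ⟨U, hUo, hU, ?_⟩
  rw [cohomologyMap_mkClass, mkClass_eq_zero_iff]
  have h1 := hθr U r fun x => by
    obtain ⟨W, hW, l, hl⟩ := hrV x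
    exact ⟨W, hW, fun z hz => hV l _ fun k => (hl _ (hz k)).2.1⟩
  have h2 := mk_pullback_sub_mem_coboundaries (X := U) (g := Subtype.val)
    (s := fun j => if j = 0 then fun x => i (r x) else Subtype.val) ξ fun x => by
      obtain ⟨W, hW, l, hl⟩ := hrV x
      refine ⟨1, W, hW, fun j hj w _ => by simp [Nat.one_le_iff_ne_zero.1 hj], fun j hj => ?_⟩
      obtain rfl : j = 0 := by omega
      exact ⟨V' (i l), fun w hw => (hl w hw).2.2, fun w hw => (hl w hw).1.2, hV' (i l)⟩
  have h3 := Submodule.add_mem _ h2 h1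
  rw [← Submodule.Quotient.mk_add] at h3
  exact (congrArg (fun ζ => Submodule.Quotient.mk ζ ∈ coboundaries R U q)
    (sub_add_cancel (pullback R (Subtype.val : U → X) q ξ)
      (pullback R (fun x => i (r x)) q ξ))).mp h3

end Tautness

/-- Let `L` be compact in the paracompact Hausdorff space `X`, and let `F` be a homotopy on
`[0, ∞)` that starts at the identity, keeps `L` invariant, and locally uniformly pushes the points
of `X` into every neighbourhood of `L`. Then `L → X` induces isomorphisms in cohomology. -/
theorem bijective_cohomologyMap_of_absorbing {R : Type*} [CommRing R] {X L : Type*}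
    [TopologicalSpace X] [TopologicalSpace L] [T2Space X] [ParacompactSpace X] [CompactSpace L]
    (i : C(L, X)) (hi : Function.Injective i) (F : ℝ≥0 → X → X)
    (hF : Continuous fun p : ℝ≥0 × X => F p.1 p.2) (hF0 : ∀ x, F 0 x = x)
    (hFi : ∀ t l, F t (i l) ∈ range i)
    (habs : ∀ U : Set X, IsOpen U → (∀ l, i l ∈ U) →
      ∀ x, ∃ T, ∀ᶠ w in 𝓝 x, ∀ t ≥ T, F t w ∈ U) (q : ℕ) :
    Function.Bijective (cohomologyMap R i q) := by
  have : T2Space L := (i.continuous.isClosedEmbedding hi).isEmbedding.t2Space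
  have key (U : Set X) (hUo : IsOpen U) (hU : ∀ l, i l ∈ U) : ∃ T : C(X, ℝ≥0), ∀ x,
      F (T x) x ∈ U := by
    -- Demanding `F t x ∈ U` for all later `t` too makes the set of admissible times convex.
    obtain ⟨T, hT⟩ := exists_continuous_forall_mem_convex_of_local_const (X := X)
      (t := fun x => {e : ℝ | 0 ≤ e ∧ ∀ t : ℝ≥0, e ≤ t → F t x ∈ U})
      (fun x => by
        refine OrdConnected.convex ⟨fun a ha b hb c hc => ?_⟩
        exact ⟨ha.1.trans hc.1, fun t h => ha.2 t (hc.1.trans h)⟩)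
      (fun x => by
        obtain ⟨T, hT⟩ := habs U hUo hU x
        exact ⟨T, hT.mono fun y hy => ⟨T.2, fun t ht => hy t (NNReal.coe_le_coe.1 ht)⟩⟩)
    exact ⟨⟨fun x => ⟨T x, (hT x).1⟩, T.continuous.subtype_mk _⟩, fun x => (hT x).2 _ le_rfl⟩
  have hH (T : C(X, ℝ≥0)) : Continuous fun p : I × X => F (unitInterval.toNNReal p.1 * T p.2) p.2 :=
    hF.comp (by fun_prop : Continuous fun p : I × X => (unitInterval.toNNReal p.1 * T p.2, p.2))
  refine ⟨(injective_iff_map_eq_zero _).2 fun c hc => ?_, fun c => ?_⟩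
  · obtain ⟨U, hUo, hU, hcU⟩ := exists_cohomologyMap_subsetIncl_eq_zero i hi c hc
    obtain ⟨T, hT⟩ := key U hUo hU
    let r : C(X, U) := ⟨fun x => ⟨F (T x) x, hT x⟩,
      (hF.comp (by fun_prop : Continuous fun x : X => (T x, x))).subtype_mk hT⟩
    let H : (ContinuousMap.id X).Homotopy ((subsetIncl U).comp r) :=
      { toFun := fun p => F (unitInterval.toNNReal p.1 * T p.2) p.2
        continuous_toFun := hH T
        map_zero_left := fun x => by simp [hF0]
        map_one_left := fun x => by simp [subsetIncl, r] }
    rw [← cohomologyMap_id q c, cohomologyMap_eq_of_homotopy H, cohomologyMap_comp, hcU, map_zero]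
  · obtain ⟨U, hU, c', hUo, rfl⟩ := exists_cohomologyMap_corestrict_eq i hi c
    obtain ⟨T, hT⟩ := key U hUo hU
    let r : C(X, U) := ⟨fun x => ⟨F (T x) x, hT x⟩,
      (hF.comp (by fun_prop : Continuous fun x : X => (T x, x))).subtype_mk hT⟩
    -- Other points of `U` may leave it before time `T`; those of `i(L)` cannot, by invariance.
    have hHU (p : I × L) : F (unitInterval.toNNReal p.1 * T (i p.2)) (i p.2) ∈ U := by
      obtain ⟨l, hl⟩ := hFi (unitInterval.toNNReal p.1 * T (i p.2)) p.2
      exact hl ▸ hU l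
    let H : (corestrict i U hU).Homotopy (r.comp i) :=
      { toFun := fun p => ⟨F (unitInterval.toNNReal p.1 * T (i p.2)) (i p.2), hHU p⟩
        continuous_toFun := ((hH T).comp
          (by fun_prop : Continuous fun p : I × L => (p.1, i p.2))).subtype_mk hHU
        map_zero_left := fun x => by simp [hF0, corestrict]
        map_one_left := fun x => by simp [r] }
    exact ⟨cohomologyMap R r q c', by
      rw [← cohomologyMap_comp, cohomologyMap_eq_of_homotopy H]⟩

end AlexanderSpanier

/-! ### Paracompactness of exhausted subspaces -/

/-- The union of a sequence of closed subsets of a paracompact space is paracompact if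
it is also the union of their interiors. -/
theorem paracompactSpace_of_iUnion_closed {M : Type*} [TopologicalSpace M] [ParacompactSpace M]
    {Z : Set M} {C : ℕ → Set M} (hC : ∀ n, IsClosed (C n))
    (hCZ : ∀ n, C n ⊆ Z) (hZ : ∀ x ∈ Z, ∃ n, x ∈ interior (C n)) : ParacompactSpace Z where
  locallyFinite_refinement α s ho hs := by
    have ho' (a : α) : ∃ t : Set M, IsOpen t ∧ Subtype.val ⁻¹' t = s a := isOpen_induced_iff.1 (ho a)
    choose t hto hts using ho'
    have hcov (n : ℕ) : C n ⊆ ⋃ a, t a := fun x hx => by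
      obtain ⟨a, ha⟩ := mem_iUnion.1 (hs.ge (mem_univ (⟨x, hCZ n hx⟩ : Z)))
      rw [← hts a] at ha
      exact mem_iUnion.2 ⟨a, ha⟩
    choose v hvo hvC hvf hvt using fun n => precise_refinement_set (hC n) t hto (hcov n)
    -- Removing the earlier `C k` leaves a cover, by the least `n` with `x ∈ C n`, and lets `C m`
    -- meet only the families with index at most `m`.
    refine ⟨ℕ × α, fun b => Subtype.val ⁻¹' (v b.1 b.2 \ ⋃ k ∈ Finset.range b.1, C k),
      fun b => ?_, ?_, fun x => ?_, fun b => ⟨b.2, ?_⟩⟩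
    · exact ((hvo _ _).sdiff
        (isClosed_biUnion_finset fun k _ => hC k)).preimage continuous_subtype_val
    · refine eq_univ_of_forall fun x => ?_
      classical
      have hx : ∃ n, (x : M) ∈ C n := (hZ x x.2).imp fun n h => interior_subset h
      obtain ⟨a, ha⟩ := mem_iUnion.1 (hvC _ (Nat.find_spec hx))
      refine mem_iUnion.2 ⟨(Nat.find hx, a), ha, fun h => ?_⟩
      obtain ⟨k, hk, hxk⟩ := mem_iUnion₂.1 h
      exact Nat.find_min hx (Finset.mem_range.1 hk) hxk
    · obtain ⟨m, hm⟩ := hZ x x.2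
      choose N hN hNf using fun n => hvf n x
      refine ⟨Subtype.val ⁻¹' (C m ∩ ⋂ n ∈ Finset.range (m + 1), N n),
        continuous_subtype_val.continuousAt (inter_mem (mem_interior_iff_mem_nhds.1 hm)
          ((Finset.range (m + 1)).iInter_mem_sets.2 fun n _ => hN n)), ?_⟩
      refine ((Finset.range (m + 1)).finite_toSet.biUnion fun n _ =>
        (hNf n).image (Prod.mk n)).subset ?_
      rintro ⟨n, a⟩ ⟨y, ⟨hyv, hyC⟩, hym, hyN⟩
      have hn : n ∈ Finset.range (m + 1) := by
        by_contra hn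
        refine hyC (mem_iUnion₂.2 ⟨m, ?_, hym⟩)
        simp only [Finset.mem_range] at hn ⊢
        omega
      exact mem_iUnion₂.2 ⟨n, hn, a, ⟨y, hyv, mem_iInter₂.1 hyN n hn⟩, rfl⟩
    · rw [← hts]
      exact preimage_mono (sdiff_subset.trans (hvt _ _))

/-! ### Stability and the basin of attraction -/

namespace Dynamics

section General

variable {τ M : Type*} [TopologicalSpace M] [AddCommMonoid τ] [LinearOrder τ] {φ : τ → M → M}
  {K : Set M}

theorem IsAttractor.mapsTo_self [T1Space M] (hK : IsAttractor φ K) {t : τ} (ht : 0 ≤ t) :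
    MapsTo (φ t) K K := by
  intro x hx
  by_contra h
  obtain ⟨P, hP, hPU, hPi⟩ := hK.stable {φ t x}ᶜ
    (isOpen_compl_singleton.mem_nhdsSet.2 fun y hy hyx => h (hyx ▸ hy))
  exact hPU (hPi ht (subset_of_mem_nhdsSet hP hx)) rfl

/-- An orbit that enters a positively invariant neighbourhood of `K` once stays there. The
hypothesis `hsub` stands in for subtraction, to cover `ℝ`, `ℝ≥0` and `ℕ` alike. -/
theorem mem_basin_of_apply (hadd : ∀ s t p, φ (s + t) p = φ s (φ t p))
    (hsub : ∀ s t : τ, s ≤ t → ∃ u, 0 ≤ u ∧ t = u + s) (hK : IsAttractor φ K) {t : τ} {p : M}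
    (h : φ t p ∈ basin φ K) : p ∈ basin φ K := by
  refine tendsto_def.2 fun U hU => ?_
  obtain ⟨P, hP, hPU, hPi⟩ := hK.stable U hU
  have : Nonempty τ := ⟨0⟩
  obtain ⟨s, hs⟩ := (h.eventually hP).exists
  filter_upwards [eventually_ge_atTop (s + t)] with t' ht'
  obtain ⟨u, hu, rfl⟩ := hsub _ _ ht'
  have hs : φ s (φ t p) ∈ P := hs
  change φ (u + (s + t)) p ∈ U
  rw [hadd, hadd]
  exact hPU (hPi hu hs)

/-- Points of the basin are locally uniformly attracted. -/
theorem IsAttractor.eventually_forall_ge (hadd : ∀ s t p, φ (s + t) p = φ s (φ t p))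
    (hsub : ∀ s t : τ, s ≤ t → ∃ u, 0 ≤ u ∧ t = u + s) (hφ : ∀ t, Continuous (φ t))
    (hK : IsAttractor φ K) {U : Set M} (hU : U ∈ 𝓝ˢ K) {p : M} (hp : p ∈ basin φ K) :
    ∃ T, ∀ᶠ w in 𝓝 p, ∀ t ≥ T, φ t w ∈ U := by
  obtain ⟨P, hP, hPU, hPi⟩ := hK.stable U hU
  have : Nonempty τ := ⟨0⟩
  obtain ⟨T, hT⟩ := (Tendsto.eventually hp
    (isOpen_interior.mem_nhdsSet.2 (subset_interior_iff_mem_nhdsSet.2 hP))).exists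
  refine ⟨T, ?_⟩
  filter_upwards [(hφ T).continuousAt.preimage_mem_nhds (isOpen_interior.mem_nhds hT)] with w hw t ht
  obtain ⟨u, hu, rfl⟩ := hsub _ _ ht
  rw [hadd]
  exact hPU (hPi hu (interior_subset hw))

/-- For a closed neighbourhood `N` of `K` inside the basin, the closed sets `φ (u n) ⁻¹' N` exhaust
the basin, and by locally uniform attraction so do their interiors. -/
theorem IsAttractor.paracompactSpace_basin [T2Space M] [ParacompactSpace M]
    (hadd : ∀ s t p, φ (s + t) p = φ s (φ t p))
    (hsub : ∀ s t : τ, s ≤ t → ∃ u, 0 ≤ u ∧ t = u + s) (hφ : ∀ t, Continuous (φ t))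
    (hK : IsAttractor φ K) {u : ℕ → τ} (hu : Tendsto u atTop atTop) :
    ParacompactSpace (basin φ K) := by
  obtain ⟨V, hV, hVb⟩ := hK.attracts
  obtain ⟨N, hN, hNc, hNV⟩ := exists_mem_nhdsSet_isClosed_subset hV hK.isCompact.isClosed
  refine paracompactSpace_of_iUnion_closed (C := fun n => φ (u n) ⁻¹' N)
    (fun n => hNc.preimage (hφ _))
    (fun n x hx => mem_basin_of_apply hadd hsub hK (hVb _ (hNV hx))) fun x hx => ?_
  obtain ⟨T, hT⟩ := hK.eventually_forall_ge hadd hsub hφ hN hx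
  obtain ⟨n, hn⟩ := (hu.eventually (eventually_ge_atTop T)).exists
  exact ⟨n, mem_interior_iff_mem_nhds.2 (hT.mono fun w hw => hw _ hn)⟩

end General

end Dynamics

/-! ### Telescoping a homotopy -/

/-- A homotopy from the identity to `f` extends to `[0, ∞)`: on `[n, n + 1]` one runs through the
homotopy after having applied `f` for `n` times. -/
theorem exists_telescope {X : Type*} [TopologicalSpace X] {f : C(X, X)}
    (H : (ContinuousMap.id X).Homotopy f) : ∃ F : ℝ≥0 → X → X,
      (Continuous fun p : ℝ≥0 × X => F p.1 p.2) ∧ (∀ x, F 0 x = x) ∧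
        ∀ t x, ∃ s : I, F t x = H (s, f^[⌊t⌋₊] x) := by
  let κ : ℕ → ℝ≥0 → I := fun n t => projIcc 0 1 zero_le_one ((t : ℝ) - n)
  have hκ (n : ℕ) : Continuous (κ n) := continuous_projIcc.comp (by fun_prop)
  -- `Q n` composes the first `n` stages, each on a clock clamped to `[0, 1]`. Stages not yet begun
  -- are the identity and finished ones are `f`, so near a given time all large `Q n` agree.
  let Q : ℕ → ℝ≥0 → X → X := fun n t x => n.rec x fun n y => H (κ n t, y)
  have hQ0 (t x) : Q 0 t x = x := rfl
  have hQs (n t x) : Q (n + 1) t x = H (κ n t, Q n t x) := rfl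
  have hQc (n : ℕ) : Continuous fun p : ℝ≥0 × X => Q n p.1 p.2 := by
    induction n with
    | zero => exact continuous_snd
    | succ n ih =>
      have := hκ n
      simp only [hQs]
      fun_prop
  have hstab (n m : ℕ) (hnm : n ≤ m) (t : ℝ≥0) (ht : t ≤ n) (x : X) : Q m t x = Q n t x := by
    induction m, hnm using Nat.le_induction with
    | base => rfl
    | succ m hm ih =>
      have h : κ m t = 0 := by
        refine projIcc_eq_zero.2 (sub_nonpos.2 ?_)
        exact_mod_cast ht.trans (Nat.cast_le.2 hm)
      rw [hQs, h, H.apply_zero, ih]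
      rfl
  have hiter (n : ℕ) (t : ℝ≥0) (ht : n ≤ t) (x : X) : Q n t x = f^[n] x := by
    induction n with
    | zero => rfl
    | succ n ih =>
      have h : κ n t = 1 := by
        refine projIcc_eq_one.2 (le_sub_iff_add_le'.2 ?_)
        exact_mod_cast ht
      rw [hQs, h, H.apply_one, ih ((Nat.cast_le.2 n.le_succ).trans ht),
        Function.iterate_succ_apply']
  refine ⟨fun t x => Q (⌊t⌋₊ + 1) t x, continuous_iff_continuousAt.2 fun p => ?_, fun x => ?_,
    fun t x =>
      ⟨κ ⌊t⌋₊ t, (hQs _ _ _).trans (by rw [hiter _ _ (Nat.floor_le zero_le)])⟩⟩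
  · obtain ⟨N, hN⟩ := exists_nat_gt p.1
    refine (hQc N).continuousAt.congr ?_
    filter_upwards [continuous_fst.continuousAt.eventually_lt_const hN] with r hr
    refine hstab (⌊r.1⌋₊ + 1) N ((Nat.floor_lt zero_le).2 hr) r.1 ?_ r.2
    exact_mod_cast (Nat.lt_floor_add_one r.1).le
  · have h : κ 0 0 = 0 := projIcc_eq_zero.2 (by simp)
    simp only [Nat.floor_zero, hQs, hQ0, h, H.apply_zero]
    rfl

/-! ### Continuous and discrete time -/

namespace Dynamics

variable {M : Type*} [TopologicalSpace M] {K : Set M}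

theorem IsAttractor.exists_isOpen_of_inclusion {τ : Type*} [Preorder τ] [Zero τ] {φ : τ → M → M}
    (hK : IsAttractor φ K) {U : Set (basin φ K)} (hU : IsOpen U) (hKU : ∀ l, hK.inclusion l ∈ U) :
    ∃ O ∈ 𝓝ˢ K, ∀ z : basin φ K, (z : M) ∈ O → z ∈ U := by
  obtain ⟨O, hO, rfl⟩ := isOpen_induced_iff.1 hU
  exact ⟨O, hO.mem_nhdsSet.2 fun x hx => hKU ⟨x, hx⟩, fun z hz => hz⟩

/-- The case of continuous time; `e` embeds `[0, ∞)` into the time set. -/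
theorem IsAttractor.bijective_cohomologyMap_inclusion [T2Space M] [ParacompactSpace M]
    {τ : Type*} [AddCommMonoid τ] [LinearOrder τ]
    [IsOrderedAddMonoid τ] {φ : τ → M → M} (hadd : ∀ s t p, φ (s + t) p = φ s (φ t p))
    (hsub : ∀ s t : τ, s ≤ t → ∃ u, 0 ≤ u ∧ t = u + s) (h0 : ∀ p, φ 0 p = p)
    (hφ : ∀ t, Continuous (φ t)) (e : ℝ≥0 → τ) (he0 : e 0 = 0) (he : Monotone e)
    (he' : Tendsto e atTop atTop) (hc : Continuous fun p : ℝ≥0 × M => φ (e p.1) p.2)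
    (hK : IsAttractor φ K) (R : Type*) [CommRing R] (q : ℕ) :
    Function.Bijective (AlexanderSpanier.cohomologyMap R hK.inclusion q) := by
  have hnn (t : ℝ≥0) : 0 ≤ e t := he0 ▸ he zero_le
  have : ParacompactSpace (basin φ K) := hK.paracompactSpace_basin hadd hsub hφ
    (u := fun n : ℕ => e n) (he'.comp tendsto_natCast_atTop_atTop)
  have : CompactSpace K := isCompact_iff_compactSpace.1 hK.isCompact
  have hmaps (t : ℝ≥0) (z : basin φ K) : φ (e t) z ∈ basin φ K := by
    have h : Tendsto (fun s => φ (s + e t) (z : M)) atTop (𝓝ˢ K) :=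
      Tendsto.comp z.2 (tendsto_atTop_mono (fun s => le_add_of_nonneg_right (hnn t)) tendsto_id)
    simp only [hadd] at h
    exact h
  refine AlexanderSpanier.bijective_cohomologyMap_of_absorbing hK.inclusion
    (Set.inclusion_injective hK.subset_basin) (fun t z => ⟨φ (e t) z, hmaps t z⟩) ?_ ?_ ?_ ?_ q
  · exact (hc.comp (by fun_prop : Continuous fun p : ℝ≥0 × basin φ K => (p.1, (p.2 : M)))).subtype_mk
      _
  · exact fun z => Subtype.ext (by simp only [he0, h0])
  · exact fun t l => ⟨⟨φ (e t) l, hK.mapsTo_self (hnn t) l.2⟩, rfl⟩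
  · intro U hU hKU z
    obtain ⟨O, hO, hOU⟩ := hK.exists_isOpen_of_inclusion hU hKU
    obtain ⟨T, hT⟩ := hK.eventually_forall_ge hadd hsub hφ hO z.2
    obtain ⟨T', hT'⟩ := (he'.eventually (eventually_ge_atTop T)).exists
    refine ⟨T', ?_⟩
    filter_upwards [continuous_subtype_val.continuousAt.eventually hT] with w hw t ht
    exact hOU _ (hw _ (hT'.trans (he ht)))

/-- The case of discrete time. -/
theorem IsAttractor.bijective_cohomologyMap_inclusion_of_iterates [T2Space M] [ParacompactSpace M]
    {g : C(M, M)}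
    (hK : IsAttractor (iterates g) K) (hg : HomotopicToIdOnPair g K) (R : Type*) [CommRing R]
    (q : ℕ) : Function.Bijective (AlexanderSpanier.cohomologyMap R hK.inclusion q) := by
  have hadd : ∀ s t p, iterates g (s + t) p = iterates g s (iterates g t p) := fun s t p =>
    Function.iterate_add_apply g s t p
  have hsub : ∀ s t : ℕ, s ≤ t → ∃ u, 0 ≤ u ∧ t = u + s := fun s t h => ⟨t - s, by omega, by omega⟩
  have hφ : ∀ n, Continuous (iterates g n) := fun n => g.continuous.iterate n
  have : ParacompactSpace (basin (iterates g) K) :=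
    hK.paracompactSpace_basin hadd hsub hφ (u := id) tendsto_id
  have : CompactSpace K := isCompact_iff_compactSpace.1 hK.isCompact
  obtain ⟨H⟩ := hg
  -- The homotopy is reversed, since the telescope must start at the identity.
  have hHK (s : I) (z : basin (iterates g) K) (hz : (z : M) ∈ K) :
      (H.toHomotopy.symm (s, z) : M) ∈ K := H.prop (unitInterval.symm s) z hz
  obtain ⟨F, hF, hF0, hFs⟩ := exists_telescope H.toHomotopy.symm
  have hiter (n : ℕ) (z : basin (iterates g) K) :
      ((basinMap g K)^[n] z : M) = iterates g n z :=
    (Function.Semiconj.iterate_right (f := Subtype.val) (ga := basinMap g K) (gb := g)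
      (fun _ => rfl) n) z
  refine AlexanderSpanier.bijective_cohomologyMap_of_absorbing hK.inclusion
    (Set.inclusion_injective hK.subset_basin) F hF hF0 (fun t l => ?_) (fun U hU hKU z => ?_) q
  · obtain ⟨s, hs⟩ := hFs t (hK.inclusion l)
    refine ⟨⟨F t (hK.inclusion l), ?_⟩, rfl⟩
    rw [hs]
    refine hHK _ _ ?_
    rw [hiter]
    exact hK.mapsTo_self (Nat.zero_le _) l.2
  -- Compactness of `I × K` gives a neighbourhood `v` of `K` that every stage of the homotopy maps
  -- into `U`; it then suffices that `g^[⌊t⌋₊]` carries points into `v`.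
  · obtain ⟨u, v, -, hv, hu, hKv, huv⟩ := generalized_tube_lemma (s := (univ : Set I))
      (t := range hK.inclusion) isCompact_univ (isCompact_range hK.inclusion.continuous)
      (hU.preimage H.toHomotopy.symm.continuous) (by
        rintro ⟨s, _⟩ ⟨-, l, rfl⟩
        exact hKU ⟨_, hHK s _ l.2⟩)
    obtain ⟨O, hO, hOv⟩ := hK.exists_isOpen_of_inclusion hv fun l => hKv (mem_range_self l)
    obtain ⟨T, hT⟩ := hK.eventually_forall_ge hadd hsub hφ hO z.2
    refine ⟨T, ?_⟩
    filter_upwards [continuous_subtype_val.continuousAt.eventually hT] with w hw t ht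
    obtain ⟨s, hs⟩ := hFs t w
    rw [hs]
    refine huv (mk_mem_prod (hu (mem_univ s)) (hOv _ ?_))
    rw [hiter]
    exact hw _ (Nat.le_floor ht)

end Dynamics

theorem mainTheorem9 {M : Type*} [TopologicalSpace M] [T2Space M] [ParacompactSpace M]
    (R : Type*) [CommRing R] (K : Set M) :
    (∀ (φ : Flow ℝ M) (hK : Dynamics.IsAttractor φ K) (q : ℕ),
      Function.Bijective (AlexanderSpanier.cohomologyMap R hK.inclusion q)) ∧
    (∀ (φ : Flow ℝ≥0 M) (hK : Dynamics.IsAttractor φ K) (q : ℕ),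
      Function.Bijective (AlexanderSpanier.cohomologyMap R hK.inclusion q)) ∧
    (∀ (g : C(M, M)) (hK : Dynamics.IsAttractor (Dynamics.iterates g) K),
      Dynamics.HomotopicToIdOnPair g K → ∀ q : ℕ,
        Function.Bijective (AlexanderSpanier.cohomologyMap R hK.inclusion q)) := by
  refine ⟨fun φ hK q => ?_, fun φ hK q => ?_, fun g hK hg q =>
    hK.bijective_cohomologyMap_inclusion_of_iterates hg R q⟩
  · exact hK.bijective_cohomologyMap_inclusion φ.map_add
      (fun s t h => ⟨t - s, sub_nonneg.2 h, (sub_add_cancel t s).symm⟩) φ.map_zero_apply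
      (fun t => φ.continuous continuous_const continuous_id) NNReal.toReal rfl
      NNReal.coe_mono (NNReal.tendsto_coe_atTop.2 tendsto_id)
      (φ.continuous (NNReal.continuous_coe.comp continuous_fst) continuous_snd) R q
  · exact hK.bijective_cohomologyMap_inclusion φ.map_add
      (fun s t h => ⟨t - s, zero_le, (tsub_add_cancel_of_le h).symm⟩) φ.map_zero_apply
      (fun t => φ.continuous continuous_const continuous_id) id rfl monotone_id tendsto_id
      (φ.continuous continuous_fst continuous_snd) R q
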